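/- A \emph{rig} in a category $\mathcal{E}$ with finite products is an object $A$ with two commutative monoid structures $(A,\cdot,1)$ and $(A,+,0)$ satisfying $a\cdot 0=0$ and $(a+b)\cdot c=a\cdot c+b\cdot c$; a morphism of rigs is a morphism of $\mathcal{E}$ preserving both monoid structures. A rig is \emph{integral} if $1+x=1$ holds. Let $\mathbf{iRig}(\mathcal{E})$ be the category of integral rigs in $\mathcal{E}$ and $\mathbf{dLat}(\mathcal{E})$ the full subcategory of distributive lattices with bottom and top, regarded as rigs via $+=\vee$, $0=\bot$, $\cdot=\wedge$, $1=\top$. If $\mathcal{E}$ has finite limits, let $\mathrm{Inv}(A)$ be the pullback of $\cdot:A\times A\to A$ along $1:1\to A$, mapped to $A$ by the first projection; a rig morphism $f:A\to B$ is \emph{local} if the square formed by the induced map $\mathrm{Inv}(A)\to\mathrm{Inv}(B)$, the maps $\mathrm{Inv}(A)\to A$ and $\mathrm{Inv}(B)\to B$, and $f$ is a pullback. \textbf{Proposition.} Let $\mathcal{E}$ be a Grothendieck topos, that is, a category equivalent to the category of sheaves of sets on a small site. Then the inclusion $\mathbf{dLat}(\mathcal{E})\to\mathbf{iRig}(\mathcal{E})$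 has a left adjoint $L$. Moreover, for every integral rig $A$ in $\mathcal{E}$, the unit $\eta_A:A\to LA$ of the adjunction is an epimorphism in $\mathcal{E}$ and is local. -/

import Mathlib

open CategoryTheory MonoidalCategory CartesianMonoidalCategory Limits

universe v u

namespace InternalRig

open scoped MonObj AddMonObj

/-- A Grothendieck topos: a category equivalent to the category of sheaves of sets on a
small site. -/
class IsGrothendieckTopos (E : Type u) [Category.{v} E] : Prop where
  exists_site : ∃ (S : Type v) (_ : SmallCategory S) (J : GrothendieckTopology S),
    Nonempty (E ≌ Sheaf J (Type v))

/-- A Grothendieck topos has finite limits. -/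
instance (E : Type u) [Category.{v} E] [IsGrothendieckTopos E] : HasFiniteLimits E where
  out K _ _ := by
    obtain ⟨S, _, J, ⟨e⟩⟩ := IsGrothendieckTopos.exists_site (E := E)
    exact Adjunction.hasLimitsOfShape_of_equivalence e.functor

variable {C : Type u} [Category.{v} C] [CartesianMonoidalCategory C] [BraidedCategory C]

/-- A rig object `(R, ·, 1, +, 0)` in a category with finite products: `(R, ·, 1)` and
`(R, +, 0)` are commutative monoid objects, and `x · 0 = 0` and `(x + y) · z = x · z + y · z`
hold. -/
class RigObj (R : C) extends
    MonObj R, IsCommMonObj R, AddMonObj R, IsCommAddMonObj R where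
  mul_zero (R) : lift (𝟙 R) (toUnit R ≫ ζ) ≫ μ = toUnit R ≫ ζ
  add_mul (R) : σ ▷ R ≫ μ = lift (fst _ _ ▷ R ≫ μ) (snd _ _ ▷ R ≫ μ) ≫ σ

variable (C) in
/-- The category of rig objects in `C`. -/
structure Rig where
  /-- The underlying object. -/
  X : C
  [rigObj : RigObj X]

attribute [instance] Rig.rigObj

namespace Rig

/-- A morphism of rig objects: a morphism that is a homomorphism for both monoid structures. -/
@[ext]
structure Hom (A B : Rig C) where
  /-- The underlying morphism. -/
  hom : A.X ⟶ B.X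
  [isRingHom : IsRingHom hom]

attribute [instance] Hom.isRingHom

instance : Category (Rig C) where
  Hom A B := Hom A B
  id A := { hom := 𝟙 A.X }
  comp f g := { hom := f.hom ≫ g.hom }

end Rig

/-- The rig object `R` is integral: `1 + x = 1`. -/
def IsIntegralRig (R : C) [RigObj R] : Prop :=
  lift (toUnit R ≫ η) (𝟙 R) ≫ σ = toUnit R ≫ η

/-- The rig object `R` is a (bounded) distributive lattice with `∨ = +`, `⊥ = 0`, `∧ = ·`,
`⊤ = 1`: the absorption laws `x ∧ (x ∨ y) = x` and `x ∨ (x ∧ y) = x` hold, the other axioms of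
bounded distributive lattices being part of the definition of a rig. -/
structure IsDistribLattice (R : C) [RigObj R] : Prop where
  inf_sup_self : lift (fst R R) σ ≫ μ = fst R R
  sup_inf_self : lift (fst R R) μ ≫ σ = fst R R

section

variable (R : C) [RigObj R]

theorem isIntegralRig_iff :
    IsIntegralRig R ↔ ∀ ⦃X : C⦄ (a : X ⟶ R), 1 + a = 1 := by
  refine ⟨fun h X a ↦ ?_, fun h ↦ ?_⟩
  · have := a ≫= h
    simpa [comp_lift_assoc, Hom.add_def, Hom.one_def] using this
  · have := h (𝟙 R)
    rwa [Hom.add_def, Hom.one_def] at this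

theorem isDistribLattice_iff :
    IsDistribLattice R ↔
      (∀ ⦃X : C⦄ (a b : X ⟶ R), a * (a + b) = a) ∧
        ∀ ⦃X : C⦄ (a b : X ⟶ R), a + a * b = a := by
  refine ⟨fun h ↦ ⟨fun X a b ↦ ?_, fun X a b ↦ ?_⟩, fun h ↦ ⟨?_, ?_⟩⟩
  · have := lift a b ≫= h.inf_sup_self
    simpa [comp_lift_assoc, Hom.add_def, Hom.mul_def] using this
  · have := lift a b ≫= h.sup_inf_self
    simpa [comp_lift_assoc, Hom.add_def, Hom.mul_def] using this
  · have := h.1 (fst R R) (snd R R)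
    simpa [comp_lift_assoc, Hom.add_def, Hom.mul_def] using this
  · have := h.2 (fst R R) (snd R R)
    simpa [comp_lift_assoc, Hom.add_def, Hom.mul_def] using this

theorem hom_add_mul {X : C} (a b c : X ⟶ R) : (a + b) * c = a * c + b * c :=
  (add_mul_iff R).1 (RigObj.add_mul R) a b c

/-- Distributive lattices are exactly the integral rigs with idempotent multiplication. -/
theorem isDistribLattice_iff_isIntegralRig :
    IsDistribLattice R ↔
      IsIntegralRig R ∧ lift (𝟙 R) (𝟙 R) ≫ μ = 𝟙 R := by
  rw [isDistribLattice_iff, isIntegralRig_iff]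
  constructor
  · rintro ⟨h, -⟩
    refine ⟨fun X a ↦ by simpa using h 1 a, ?_⟩
    have := h (𝟙 R) 0
    rwa [add_zero] at this
  · rintro ⟨h, h'⟩
    have hc : ∀ ⦃X : C⦄ (a b : X ⟶ R), a + a * b = a := fun X a b ↦ by
      have := hom_add_mul R 1 b a
      rw [h, one_mul, mul_comm b a] at this
      exact this.symm
    refine ⟨fun X a b ↦ ?_, hc⟩
    have hi : a * a = a := by
      have := a ≫= h'
      simpa [comp_lift_assoc, Hom.mul_def] using this
    rw [mul_comm, hom_add_mul, hi, mul_comm b a, hc]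

end

variable (C) in
/-- The property of being an integral rig, on rigs in `C`. -/
def isIntegralRig : ObjectProperty (Rig C) := fun A ↦ IsIntegralRig A.X

variable (C) in
/-- The property of being a distributive lattice, on rigs in `C`. -/
def isDistribLattice : ObjectProperty (Rig C) := fun A ↦ IsDistribLattice A.X

variable (C) in
theorem isDistribLattice_le : isDistribLattice C ≤ isIntegralRig C :=
  fun A h ↦ ((isDistribLattice_iff_isIntegralRig A.X).1 h).1

variable (C) in
/-- The category of integral rigs in `C`, a full subcategory of the category of rigs. -/
abbrev IRig := (isIntegralRig C).FullSubcategory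

variable (C) in
/-- The category of distributive lattices in `C`, a full subcategory of the category of rigs. -/
abbrev DLat := (isDistribLattice C).FullSubcategory

variable (C) in
/-- The inclusion of distributive lattices into integral rigs. -/
abbrev inclusion : DLat C ⥤ IRig C := ObjectProperty.ιOfLE (isDistribLattice_le C)

section Local

variable [HasPullbacks C]

/-- The object of pairs `(x, y)` of elements of `R` with `x · y = 1`. -/
noncomputable abbrev invObj (R : C) [RigObj R] : C := pullback (μ : R ⊗ R ⟶ R) η

/-- The first projection `(x, y) ↦ x`, through which `invObj R` is the subobject of invertible
elements of `R`. -/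
noncomputable def invι (R : C) [RigObj R] : invObj R ⟶ R := pullback.fst _ _ ≫ fst R R

/-- The map `(x, y) ↦ (f x, f y)` on invertible elements induced by a rig morphism `f`. -/
noncomputable def invMap {A B : C} [RigObj A] [RigObj B] (f : A ⟶ B) [IsRingHom f] :
    invObj A ⟶ invObj B :=
  pullback.map _ _ _ _ (f ⊗ₘ f) (𝟙 _) f (IsMonHom.mul_hom f) (by simp)

/-- A rig morphism `f : A ⟶ B` is local if the square
```
invObj A ⟶ invObj B
   |           |
   A    ⟶     B
```
is a pullback, i.e. an element of `A` is invertible as soon as its image in `B` is. -/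
def IsLocalRigHom {A B : Rig C} (f : A ⟶ B) : Prop :=
  IsPullback (invMap f.hom) (invι A.X) (invι B.X) f.hom

end Local

end InternalRig

namespace InternalRig

open scoped MonObj AddMonObj

/-- Maps equalizing the membership in a subobject are coequalized by its classifying map. -/
theorem comp_χ_eq {C : Type u} [Category.{v} C] [HasPullbacks C] (c : Subobject.Classifier C)
    {U X Y : C} (i : U ⟶ Y) [Mono i] (f g : X ⟶ Y)
    (h : ∀ ⦃T : C⦄ (x : T ⟶ X), (∃ y, y ≫ i = x ≫ f) ↔ ∃ y, y ≫ i = x ≫ g) :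
    f ≫ c.χ i = g ≫ c.χ i := by
  obtain ⟨y, hy⟩ := (h (pullback.fst f i)).1 ⟨_, pullback.condition.symm⟩
  have h₁ : IsPullback (pullback.fst f i) (pullback.snd f i) f i := .of_hasPullback f i
  have h₂ : IsPullback (pullback.fst f i) y g i := by
    refine ⟨⟨hy.symm⟩, ⟨PullbackCone.IsLimit.mk _
      (fun s ↦ pullback.lift s.fst ((h s.fst).2 ⟨s.snd, s.condition.symm⟩).choose
        ((h s.fst).2 ⟨s.snd, s.condition.symm⟩).choose_spec.symm) (fun s ↦ pullback.lift_fst _ _ _)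
        (fun s ↦ ?_) (fun s t ht _ ↦ ?_)⟩⟩
    · rw [← cancel_mono i, Category.assoc, hy, pullback.lift_fst_assoc, s.condition]
    · rw [← cancel_mono (pullback.fst f i), ht, pullback.lift_fst]
  rw [c.uniq _ (h₁.paste_vert (c.isPullback i)), c.uniq _ (h₂.paste_vert (c.isPullback i))]

variable {C : Type u} [Category.{v} C] [CartesianMonoidalCategory C] [BraidedCategory C]

section QuotientMonoid

variable [MonoidalClosed C]

instance epi_whiskerLeft (X : C) {A B : C} (f : A ⟶ B) [Epi f] : Epi (X ◁ f) :=
  inferInstanceAs (Epi ((tensorLeft X).map f))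

instance epi_whiskerRight (X : C) {A B : C} (f : A ⟶ B) [Epi f] : Epi (f ▷ X) :=
  inferInstanceAs (Epi ((tensorRight X).map f))

instance epi_tensorHom {A B A' B' : C} (f : A ⟶ B) (g : A' ⟶ B') [Epi f] [Epi g] :
    Epi (f ⊗ₘ g) := by
  rw [MonoidalCategory.tensorHom_def]
  infer_instance

/-- The quotient of a monoid object by an epimorphism along which the multiplication descends. -/
@[to_additive
/-- The quotient of an additive monoid object by an epimorphism along which the addition
descends. -/]
abbrev monObjOfEpi {A Q : C} [MonObj A] (π : A ⟶ Q) [Epi π]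
    (m : Q ⊗ Q ⟶ Q) (hm : (π ⊗ₘ π) ≫ m = μ ≫ π) : MonObj Q where
  one := η ≫ π
  mul := m
  one_mul := by
    rw [← cancel_epi (𝟙_ C ◁ π), comp_whiskerRight_assoc, whisker_exchange_assoc,
      ← tensorHom_def'_assoc, hm, MonObj.one_mul_assoc,
      leftUnitor_naturality]
  mul_one := by
    rw [← cancel_epi (π ▷ 𝟙_ C), MonoidalCategory.whiskerLeft_comp_assoc,
      ← whisker_exchange_assoc, ← MonoidalCategory.tensorHom_def_assoc, hm,
      MonObj.mul_one_assoc, rightUnitor_naturality]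
  mul_assoc := by
    rw [← cancel_epi ((π ⊗ₘ π) ⊗ₘ π), associator_naturality_assoc, ← tensorHom_id,
      ← id_tensorHom, tensorHom_comp_tensorHom_assoc, tensorHom_comp_tensorHom_assoc, hm]
    have h₁ : (μ ≫ π) ⊗ₘ π ≫ 𝟙 Q = μ ▷ A ≫ (π ⊗ₘ π) := by
      simp [← tensorHom_id]
    have h₂ : (π ≫ 𝟙 Q) ⊗ₘ (μ ≫ π) = A ◁ μ ≫ (π ⊗ₘ π) := by
      simp [← id_tensorHom]
    rw [h₁, h₂, Category.assoc, Category.assoc, hm, MonObj.mul_assoc_assoc]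

end QuotientMonoid

theorem hom_mul_zero (R : C) [RigObj R] {X : C} (a : X ⟶ R) : a * 0 = 0 := by
  have := a ≫= RigObj.mul_zero R
  simpa [comp_lift_assoc, Hom.mul_def, Hom.zero_def] using this

/-- Generalized elements of a rig object form a commutative semiring. -/
abbrev homCommSemiring (R : C) [RigObj R] (X : C) : CommSemiring (X ⟶ R) where
  __ := Hom.addCommMonoid
  __ := Hom.commMonoid
  left_distrib a b c := by rw [mul_comm, hom_add_mul, mul_comm b, mul_comm c]
  right_distrib := hom_add_mul R
  zero_mul a := by rw [mul_comm, hom_mul_zero]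
  mul_zero := hom_mul_zero R

section

variable {R : C} [RigObj R] {X Y : C}

theorem comp_mul (t : Y ⟶ X) (a b : X ⟶ R) : t ≫ (a * b) = (t ≫ a) * (t ≫ b) := by
  simp [Hom.mul_def, comp_lift_assoc]

theorem comp_add (t : Y ⟶ X) (a b : X ⟶ R) : t ≫ (a + b) = t ≫ a + t ≫ b := by
  simp [Hom.add_def, comp_lift_assoc]

theorem comp_one (t : Y ⟶ X) : t ≫ (1 : X ⟶ R) = 1 := by
  simp [Hom.one_def]

theorem IsIntegralRig.one_add (h : IsIntegralRig R) (a : X ⟶ R) : 1 + a = 1 :=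
  (isIntegralRig_iff R).1 h a

theorem IsIntegralRig.add_mul_self (h : IsIntegralRig R) (a b : X ⟶ R) : a + a * b = a := by
  let := homCommSemiring R X
  calc a + a * b = a * (1 + b) := by ring
    _ = a := by rw [h.one_add, mul_one]

theorem IsIntegralRig.eq_one_of_mul_eq_one (h : IsIntegralRig R) {a b : X ⟶ R}
    (hab : a * b = 1) : a = 1 := by
  have := h.add_mul_self a b
  rw [hab, add_comm, h.one_add] at this
  exact this.symm

theorem IsIntegralRig.eq_one_of_add_eq (h : IsIntegralRig R) {a b : X ⟶ R}
    (ha : a = 1) (hab : a + b = b) : b = 1 := by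
  rw [← hab, ha, h.one_add]

/-- In an integral rig, `a + b * c = 1` if and only if `a + b * c ^ 2 = 1`. -/
theorem IsIntegralRig.add_mul_eq_one_iff (h : IsIntegralRig R) (a b c : X ⟶ R) :
    a + b * c = 1 ↔ a + b * (c * c) = 1 := by
  let := homCommSemiring R X
  constructor <;> intro H
  · have h1 : (a + b * c) * (a + b * c) = 1 := by rw [H, mul_one]
    refine h.eq_one_of_add_eq h1 ?_
    calc (a + b * c) * (a + b * c) + (a + b * (c * c))
        = (a + a * (a + b * c + b * c)) + (b * (c * c) + b * (c * c) * b) := by ring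
      _ = a + b * (c * c) := by rw [h.add_mul_self, h.add_mul_self]
  · refine h.eq_one_of_add_eq H ?_
    calc a + b * (c * c) + (a + b * c) = (a + a * 1) + (b * c + (b * c) * c) := by ring
      _ = a + b * c := by rw [h.add_mul_self, h.add_mul_self]

end

section Quotient

variable (A : C) [RigObj A]

/-- The operation `(a, b, c) ↦ a + b * c`. -/
def affine : (A ⊗ A) ⊗ A ⟶ A :=
  fst _ _ ≫ fst _ _ + (fst _ _ ≫ snd _ _) * snd _ _

/-- The operation `(a, b, c) ↦ a + b * c ^ 2`. -/
def affineSq : (A ⊗ A) ⊗ A ⟶ A :=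
  fst _ _ ≫ fst _ _ + (fst _ _ ≫ snd _ _) * (snd _ _ * snd _ _)

variable {A}

theorem lift_affine {X : C} (a b c : X ⟶ A) : lift (lift a b) c ≫ affine A = a + b * c := by
  simp [affine, comp_add, comp_mul]

theorem lift_affineSq {X : C} (a b c : X ⟶ A) :
    lift (lift a b) c ≫ affineSq A = a + b * (c * c) := by
  simp [affineSq, comp_add, comp_mul]

theorem comp_affine {X : C} (t : X ⟶ (A ⊗ A) ⊗ A) :
    t ≫ affine A = t ≫ fst _ _ ≫ fst _ _ + (t ≫ fst _ _ ≫ snd _ _) * (t ≫ snd _ _) := by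
  simp [affine, comp_add, comp_mul]

theorem comp_affineSq {X : C} (t : X ⟶ (A ⊗ A) ⊗ A) :
    t ≫ affineSq A = t ≫ fst _ _ ≫ fst _ _ +
      (t ≫ fst _ _ ≫ snd _ _) * ((t ≫ snd _ _) * (t ≫ snd _ _)) := by
  simp [affineSq, comp_add, comp_mul]

variable [HasCoequalizers C]

variable (A) in
/-- The quotient of `A` by the congruence generated by `c ≡ c ^ 2`. -/
noncomputable abbrev quot : C := coequalizer (affine A) (affineSq A)

variable (A) in
/-- The projection onto the quotient. -/
noncomputable abbrev quotπ : A ⟶ quot A := coequalizer.π (affine A) (affineSq A)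

theorem add_mul_comp_quotπ {X : C} (a b c : X ⟶ A) :
    (a + b * c) ≫ quotπ A = (a + b * (c * c)) ≫ quotπ A := by
  have := lift (lift a b) c ≫= coequalizer.condition (affine A) (affineSq A)
  rwa [← Category.assoc, ← Category.assoc, lift_affine, lift_affineSq] at this

theorem whiskerLeft_affine_mul :
    A ◁ affine A ≫ μ ≫ quotπ A = A ◁ affineSq A ≫ μ ≫ quotπ A := by
  let := homCommSemiring A (A ⊗ (A ⊗ A) ⊗ A)
  have key (f : (A ⊗ A) ⊗ A ⟶ A) : A ◁ f ≫ μ = fst _ _ * (snd _ _ ≫ f) := by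
    rw [Hom.mul_def]; congr 1; ext <;> simp
  rw [← Category.assoc, ← Category.assoc, key, key, comp_affine, comp_affineSq]
  have distrib (x a b c : A ⊗ (A ⊗ A) ⊗ A ⟶ A) : x * (a + b * c) = x * a + x * b * c := by ring
  rw [distrib, distrib]
  exact add_mul_comp_quotπ _ _ _

theorem whiskerLeft_affine_add :
    A ◁ affine A ≫ σ ≫ quotπ A = A ◁ affineSq A ≫ σ ≫ quotπ A := by
  have key (f : (A ⊗ A) ⊗ A ⟶ A) : A ◁ f ≫ σ = fst _ _ + (snd _ _ ≫ f) := by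
    rw [Hom.add_def]; congr 1; ext <;> simp
  rw [← Category.assoc, ← Category.assoc, key, key, comp_affine, comp_affineSq,
    ← add_assoc, ← add_assoc]
  exact add_mul_comp_quotπ (_ + _) _ _

end Quotient

/-- A commutative operation compatible with a relation in one variable descends to the
coequalizer. -/
theorem exists_coequalizer_desc₂ [MonoidalClosed C]
    {T A : C} (f g : T ⟶ A) [HasCoequalizer f g] (m : A ⊗ A ⟶ A) (hc : (β_ A A).hom ≫ m = m)
    (h : A ◁ f ≫ m ≫ coequalizer.π f g = A ◁ g ≫ m ≫ coequalizer.π f g) :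
    ∃ m' : coequalizer f g ⊗ coequalizer f g ⟶ coequalizer f g,
      (coequalizer.π f g ⊗ₘ coequalizer.π f g) ≫ m' = m ≫ coequalizer.π f g := by
  have h' : f ▷ A ≫ m ≫ coequalizer.π f g = g ▷ A ≫ m ≫ coequalizer.π f g := by
    rw [← hc, Category.assoc, BraidedCategory.braiding_naturality_left_assoc,
      BraidedCategory.braiding_naturality_left_assoc, h]
  have l := isColimitOfHasCoequalizerOfPreservesColimit (tensorLeft A) f g
  have r := isColimitOfHasCoequalizerOfPreservesColimit (tensorRight (coequalizer f g)) f g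
  obtain ⟨m₁, hm₁⟩ := Cofork.IsColimit.desc' l (m ≫ coequalizer.π f g) h
  dsimp at m₁ hm₁
  obtain ⟨m₂, hm₂⟩ := Cofork.IsColimit.desc' r m₁ (by
    dsimp
    rw [← cancel_epi (T ◁ coequalizer.π f g), whisker_exchange_assoc, whisker_exchange_assoc,
      hm₁, h'])
  dsimp at m₂ hm₂
  exact ⟨m₂, by rw [tensorHom_def', Category.assoc, hm₂, hm₁]⟩

theorem add_comp {R S X : C} [RigObj R] [RigObj S] (a b : X ⟶ R) (f : R ⟶ S) [IsRingHom f] :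
    (a + b) ≫ f = a ≫ f + b ≫ f :=
  map_add (IsAddMonHom.addMonoidHom f X) a b

theorem mul_comp {R S X : C} [RigObj R] [RigObj S] (a b : X ⟶ R) (f : R ⟶ S) [IsRingHom f] :
    (a * b) ≫ f = a ≫ f * b ≫ f :=
  map_mul (IsMonHom.monoidHom f X) a b

theorem one_comp {R S : C} (X : C) [RigObj R] [RigObj S] (f : R ⟶ S) [IsRingHom f] :
    (1 : X ⟶ R) ≫ f = 1 :=
  map_one (IsMonHom.monoidHom f X)

section

variable [MonoidalClosed C]

/-- The quotient of a rig object by an epimorphism along which both operations descend. -/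
abbrev rigObjOfEpi {A Q : C} [RigObj A] (π : A ⟶ Q) [Epi π] (s m : Q ⊗ Q ⟶ Q)
    (hs : (π ⊗ₘ π) ≫ s = σ ≫ π) (hm : (π ⊗ₘ π) ≫ m = μ ≫ π) : RigObj Q where
  __ := monObjOfEpi π m hm
  __ := addMonObjOfEpi π s hs
  mul_comm := by
    change _ ≫ m = m
    rw [← cancel_epi (π ⊗ₘ π), BraidedCategory.braiding_naturality_assoc, hm,
      IsCommMonObj.mul_comm_assoc]
  add_comm := by
    change _ ≫ s = s
    rw [← cancel_epi (π ⊗ₘ π), BraidedCategory.braiding_naturality_assoc, hs,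
      ← Category.assoc, IsCommAddMonObj.add_comm]
  mul_zero := by
    change lift _ (_ ≫ ζ ≫ π) ≫ m = _ ≫ ζ ≫ π
    have h : π ≫ lift (𝟙 Q) (toUnit Q ≫ ζ ≫ π) =
        lift (𝟙 A) (toUnit A ≫ ζ) ≫ (π ⊗ₘ π) := by ext <;> simp
    rw [← cancel_epi π, reassoc_of% h, hm, reassoc_of% RigObj.mul_zero A,
      ← Category.assoc π, comp_toUnit]
  add_mul := by
    change s ▷ Q ≫ m = lift (_ ▷ Q ≫ m) (_ ▷ Q ≫ m) ≫ s
    have h₁ : ((π ⊗ₘ π) ⊗ₘ π) ≫ s ▷ Q = σ ▷ A ≫ (π ⊗ₘ π) := by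
      rw [← tensorHom_id, ← tensorHom_id, tensorHom_comp_tensorHom, hs,
        tensorHom_comp_tensorHom, Category.comp_id, Category.id_comp]
    have hfst : ((π ⊗ₘ π) ⊗ₘ π) ≫ fst Q Q ▷ Q = fst A A ▷ A ≫ (π ⊗ₘ π) := by
      ext <;> simp [-associator_conjugation]
    have hsnd : ((π ⊗ₘ π) ⊗ₘ π) ≫ snd Q Q ▷ Q = snd A A ▷ A ≫ (π ⊗ₘ π) := by
      ext <;> simp [-associator_conjugation]
    have h₂ : ((π ⊗ₘ π) ⊗ₘ π) ≫ lift (fst Q Q ▷ Q ≫ m) (snd Q Q ▷ Q ≫ m) =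
        lift (fst A A ▷ A ≫ μ) (snd A A ▷ A ≫ μ) ≫ (π ⊗ₘ π) := by
      rw [comp_lift, reassoc_of% hfst, reassoc_of% hsnd, hm, lift_map, Category.assoc,
        Category.assoc]
    rw [← cancel_epi ((π ⊗ₘ π) ⊗ₘ π), reassoc_of% h₁, hm, reassoc_of% h₂, hs,
      reassoc_of% RigObj.add_mul A]

/-- The projection onto a quotient rig is a morphism of rigs. -/
theorem isRingHom_rigObjOfEpi {A Q : C} [RigObj A] (π : A ⟶ Q) [Epi π] (s m : Q ⊗ Q ⟶ Q)
    (hs : (π ⊗ₘ π) ≫ s = σ ≫ π) (hm : (π ⊗ₘ π) ≫ m = μ ≫ π) :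
    letI := rigObjOfEpi π s m hs hm
    IsRingHom π :=
  letI := rigObjOfEpi π s m hs hm
  { zero_hom := rfl
    add_hom := hs.symm
    one_hom := rfl
    mul_hom := hm.symm }

/-- A morphism out of a quotient of a rig is a rig morphism if its restriction is. -/
theorem isRingHom_of_epi_comp {A Q D : C} [RigObj A] [RigObj Q] [RigObj D] (π : A ⟶ Q) [Epi π]
    [IsRingHom π] (k : Q ⟶ D) [IsRingHom (π ≫ k)] : IsRingHom k where
  zero_hom := by rw [← IsAddMonHom.zero_hom π, Category.assoc, IsAddMonHom.zero_hom]
  add_hom := by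
    rw [← cancel_epi (π ⊗ₘ π), ← IsAddMonHom.add_hom_assoc, IsAddMonHom.add_hom (π ≫ k),
      tensorHom_comp_tensorHom_assoc]
  one_hom := by rw [← IsMonHom.one_hom π, Category.assoc, IsMonHom.one_hom]
  mul_hom := by
    rw [← cancel_epi (π ⊗ₘ π), ← IsMonHom.mul_hom_assoc, IsMonHom.mul_hom (π ≫ k),
      tensorHom_comp_tensorHom_assoc]

variable [HasCoequalizers C]

/-- Every integral rig `A` has a reflection in distributive lattices, whose underlying morphism
is the projection onto `quot A`. -/
theorem exists_reflection (A : IRig C) :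
    ∃ (Q : DLat C) (p : A ⟶ (inclusion C).obj Q),
      Epi p.hom.hom ∧
      (∀ {Z : C} (h : A.obj.X ⟶ Z), affine A.obj.X ≫ h = affineSq A.obj.X ≫ h →
        ∃ k, p.hom.hom ≫ k = h) ∧
      ∀ (D : DLat C) (f : A ⟶ (inclusion C).obj D), ∃ k : Q ⟶ D, p ≫ (inclusion C).map k = f := by
  obtain ⟨X, hX⟩ := A
  obtain ⟨X⟩ := X
  obtain ⟨s, hs⟩ := exists_coequalizer_desc₂ (affine X) (affineSq X) σ
    (IsCommAddMonObj.add_comm X) whiskerLeft_affine_add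
  obtain ⟨m, hm⟩ := exists_coequalizer_desc₂ (affine X) (affineSq X) μ
    (IsCommMonObj.mul_comm X) whiskerLeft_affine_mul
  let := rigObjOfEpi (quotπ X) s m hs hm
  have hπ : IsRingHom (quotπ X) := isRingHom_rigObjOfEpi (quotπ X) s m hs hm
  have hQ : IsDistribLattice (quot X) := by
    rw [isDistribLattice_iff_isIntegralRig]
    constructor
    · have h : quotπ X ≫ lift (toUnit (quot X) ≫ η) (𝟙 (quot X)) =
          lift (toUnit X ≫ η) (𝟙 X) ≫ (quotπ X ⊗ₘ quotπ X) := by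
        ext <;> simp
      have hX' : lift (toUnit X ≫ η) (𝟙 X) ≫ σ = toUnit X ≫ η := hX
      rw [IsIntegralRig, ← cancel_epi (quotπ X), reassoc_of% h, ← IsAddMonHom.add_hom,
        reassoc_of% hX', IsMonHom.one_hom, ← Category.assoc (quotπ X), comp_toUnit]
    · have h : quotπ X ≫ lift (𝟙 (quot X)) (𝟙 (quot X)) =
          lift (𝟙 X) (𝟙 X) ≫ (quotπ X ⊗ₘ quotπ X) := by
        ext <;> simp
      have h' := add_mul_comp_quotπ (0 : X ⟶ X) 1 (𝟙 X)
      rw [zero_add, zero_add, one_mul, one_mul, Category.id_comp, Hom.mul_def,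
        Category.assoc] at h'
      rw [← cancel_epi (quotπ X), reassoc_of% h, ← IsMonHom.mul_hom, ← h', Category.comp_id]
  refine ⟨⟨⟨quot X⟩, hQ⟩, ⟨⟨quotπ X⟩⟩, inferInstanceAs (Epi (quotπ X)),
    fun h hh ↦ ⟨coequalizer.desc h hh, coequalizer.π_desc h hh⟩, fun D f ↦ ?_⟩
  obtain ⟨⟨D⟩, hD⟩ := D
  obtain ⟨⟨f, hf : IsRingHom f⟩⟩ := f
  dsimp at f
  have hD' := ((isDistribLattice_iff_isIntegralRig D).1 hD).2
  have hff : affine X ≫ f = affineSq X ≫ f := by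
    have hsq {T : C} (d : T ⟶ D) : d * d = d := by
      have := d ≫= hD'
      rwa [comp_lift_assoc, Category.comp_id, ← Hom.mul_def] at this
    rw [affine, affineSq, add_comp, add_comp, mul_comp, mul_comp, mul_comp, hsq]
  have : IsRingHom (quotπ X ≫ coequalizer.desc f hff) := by
    rwa [coequalizer.π_desc]
  have := isRingHom_of_epi_comp (quotπ X) (coequalizer.desc f hff)
  exact ⟨⟨⟨coequalizer.desc f hff⟩⟩, by
    ext
    exact Rig.Hom.ext (coequalizer.π_desc f hff)⟩

end

section Local

variable [HasPullbacks C]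

theorem invι_mul_snd (R : C) [RigObj R] :
    invι R * (pullback.fst (μ : R ⊗ R ⟶ R) η ≫ snd R R) = 1 := by
  rw [Hom.mul_def, invι, ← comp_lift, lift_fst_snd, Category.comp_id, pullback.condition,
    Hom.one_def, toUnit_unique (pullback.snd _ _) (toUnit _)]

/-- The only invertible element of an integral rig is `1`. -/
theorem IsIntegralRig.invι_eq_one {R : C} [RigObj R] (h : IsIntegralRig R) : invι R = 1 :=
  h.eq_one_of_mul_eq_one (invι_mul_snd R)

theorem IsIntegralRig.comp_invι_eq_one {R : C} [RigObj R] (h : IsIntegralRig R) {T : C}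
    (t : T ⟶ invObj R) : t ≫ invι R = 1 := by
  rw [h.invι_eq_one, comp_one]

theorem IsIntegralRig.mono_invι {R : C} [RigObj R] (h : IsIntegralRig R) : Mono (invι R) where
  right_cancellation a b _ := by
    have h₁ : pullback.fst (μ : R ⊗ R ⟶ R) η ≫ fst R R = 1 := h.invι_eq_one
    have h₂ : pullback.fst (μ : R ⊗ R ⟶ R) η ≫ snd R R = 1 :=
      h.eq_one_of_mul_eq_one ((mul_comm _ _).trans (invι_mul_snd R))
    ext
    · rw [Category.assoc, Category.assoc, h₁, comp_one, comp_one]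
    · rw [Category.assoc, Category.assoc, h₂, comp_one, comp_one]

/-- A morphism of integral rigs reflecting `1` is local. -/
theorem isLocalRigHom_of_reflects_one {A B : Rig C} (hA : IsIntegralRig A.X)
    (hB : IsIntegralRig B.X) (f : A ⟶ B)
    (hf : ∀ ⦃T : C⦄ (x : T ⟶ A.X), x ≫ f.hom = 1 → x = 1) : IsLocalRigHom f := by
  have := hA.mono_invι
  have := hB.mono_invι
  have w : invMap f.hom ≫ invι B.X = invι A.X ≫ f.hom := by
    rw [invMap, invι, invι, pullback.map, pullback.lift_fst_assoc, Category.assoc, tensorHom_fst,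
      Category.assoc]
  refine ⟨⟨w⟩, ⟨PullbackCone.IsLimit.mk _
    (fun s ↦ pullback.lift (lift 1 1) (toUnit _) ?_) (fun s ↦ ?_) (fun s ↦ ?_)
    (fun s t _ ht ↦ ?_)⟩⟩
  · exact (one_mul (1 : s.pt ⟶ A.X))
  all_goals
    have hs : s.snd = 1 := hf _ (s.condition.symm.trans (hB.comp_invι_eq_one _))
  · exact (cancel_mono (invι B.X)).1
      ((hB.comp_invι_eq_one _).trans (hB.comp_invι_eq_one _).symm)
  · exact (hA.comp_invι_eq_one _).trans hs.symm
  · exact (cancel_mono (invι A.X)).1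
      ((hA.comp_invι_eq_one _).trans (hA.comp_invι_eq_one _).symm)

end Local

section Adjunction

variable [MonoidalClosed C] [HasCoequalizers C]

variable (C) in
/-- Distributive lattices are reflective in integral rigs. -/
theorem isRightAdjoint_inclusion : (inclusion C).IsRightAdjoint := by
  have (A : IRig C) : HasInitial (StructuredArrow A (inclusion C)) := by
    obtain ⟨Q, p, _, -, hp⟩ := exists_reflection A
    refine IsInitial.hasInitial (X := StructuredArrow.mk p)
      (IsInitial.ofUniqueHom (fun D ↦ StructuredArrow.homMk (hp _ D.hom).choose
        (hp _ D.hom).choose_spec) fun D m ↦ ?_)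
    have h := (StructuredArrow.w m).trans (hp _ D.hom).choose_spec.symm
    refine StructuredArrow.ext _ _ (ObjectProperty.hom_ext _ (Rig.Hom.ext ?_))
    rw [← cancel_epi p.hom.hom]
    exact congrArg (fun f ↦ f.hom.hom) h
  exact isRightAdjointOfStructuredArrowInitials _

variable {L : IRig C ⥤ DLat C}

/-- The unit of the reflection of integral rigs in distributive lattices is an epimorphism. -/
theorem epi_unit (adj : L ⊣ inclusion C) (A : IRig C) : Epi (adj.unit.app A).hom.hom := by
  obtain ⟨Q, p, _, -, hp⟩ := exists_reflection A
  obtain ⟨k, hk⟩ := hp _ (adj.unit.app A)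
  let l := (adj.homEquiv _ _).symm p
  have hl : adj.unit.app A ≫ (inclusion C).map l = p := by
    simpa [adj.homEquiv_unit] using (adj.homEquiv _ _).apply_symm_apply p
  have hlk : l ≫ k = 𝟙 _ := by
    apply (adj.homEquiv _ _).injective
    rw [adj.homEquiv_unit, adj.homEquiv_unit, Functor.map_comp, reassoc_of% hl, hk,
      CategoryTheory.Functor.map_id]
    exact (Category.comp_id _).symm
  have : Epi k.hom.hom := by
    have : l.hom.hom ≫ k.hom.hom = 𝟙 _ := congrArg (fun f ↦ f.hom.hom) hlk
    exact SplitEpi.epi ⟨_, this⟩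
  have h : p.hom.hom ≫ k.hom.hom = (adj.unit.app A).hom.hom := congrArg (fun f ↦ f.hom.hom) hk
  rw [← h]
  infer_instance

/-- The unit of the reflection of integral rigs in distributive lattices is local. -/
theorem isLocalRigHom_unit [HasPullbacks C] (c : Subobject.Classifier C)
    (adj : L ⊣ inclusion C) (A : IRig C) :
    IsLocalRigHom (adj.unit.app A).hom := by
  have hA : IsIntegralRig A.obj.X := A.property
  refine isLocalRigHom_of_reflects_one hA ((inclusion C).obj (L.obj A)).property _ fun T x hx ↦ ?_
  obtain ⟨Q, p, _, hQ, -⟩ := exists_reflection A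
  let l := (adj.homEquiv _ _).symm p
  have hl : adj.unit.app A ≫ (inclusion C).map l = p := by
    simpa [adj.homEquiv_unit] using (adj.homEquiv _ _).apply_symm_apply p
  have hp : (adj.unit.app A).hom.hom ≫ l.hom.hom = p.hom.hom := congrArg (fun f ↦ f.hom.hom) hl
  have factor_iff {X : C} (y : X ⟶ A.obj.X) : (∃ z, z ≫ η[A.obj.X] = y) ↔ y = 1 :=
    ⟨fun ⟨z, hz⟩ ↦ by rw [← hz, Hom.one_def, toUnit_unique z (toUnit _)], fun h ↦ ⟨_, h.symm⟩⟩
  obtain ⟨k, hk⟩ := hQ (c.χ η[A.obj.X]) (comp_χ_eq c _ _ _ fun X y ↦ by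
    rw [factor_iff, factor_iff, comp_affine, comp_affineSq, hA.add_mul_eq_one_iff])
  have hx' : x ≫ p.hom.hom = 1 := by
    rw [← hp, ← Category.assoc, hx]
    exact one_comp _ _
  refine (factor_iff x).1 ⟨(c.isPullback η[A.obj.X]).lift x (c.χ₀ T) ?_,
    (c.isPullback η[A.obj.X]).lift_fst _ _ _⟩
  have h₁ : (1 : T ⟶ A.obj.X) ≫ p.hom.hom = 1 := one_comp _ _
  rw [← hk, ← Category.assoc, hx', ← h₁, Category.assoc, hk, Hom.one_def, Category.assoc,
    (c.isPullback η[A.obj.X]).w, ← Category.assoc]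
  congr 1
  subsingleton

end Adjunction

end InternalRig

theorem mainTheorem10 (E : Type u) [Category.{v} E] [CartesianMonoidalCategory E]
    [BraidedCategory E] [InternalRig.IsGrothendieckTopos E] :
    (InternalRig.inclusion E).IsRightAdjoint ∧
      ∀ (L : InternalRig.IRig E ⥤ InternalRig.DLat E) (adj : L ⊣ InternalRig.inclusion E)
        (A : InternalRig.IRig E),
        Epi (adj.unit.app A).hom.hom ∧ InternalRig.IsLocalRigHom (adj.unit.app A).hom := by
  obtain ⟨S, _, J, ⟨e⟩⟩ := InternalRig.IsGrothendieckTopos.exists_site (E := E)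
  have h : MonoidalClosed (Sheaf J (Type v)) := inferInstance
  let : MonoidalClosed E := @cartesianClosedOfEquiv _ _ _ _ _ _ e.symm h
  have : HasCoequalizers E := Adjunction.hasColimitsOfShape_of_equivalence e.functor
  obtain ⟨c⟩ : Nonempty (Subobject.Classifier E) :=
    ⟨(HasSubobjectClassifier.exists_classifier (C := Sheaf J (Type v))).some.ofEquivalence e.symm⟩
  exact ⟨InternalRig.isRightAdjoint_inclusion E, fun L adj A ↦
    ⟨InternalRig.epi_unit adj A, InternalRig.isLocalRigHom_unit c adj A⟩⟩
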